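/- Let $(\Omega,\mathcal F)$ be a measurable space and $\mathcal P$ a set of probability measures on it. A set is polar if it is contained in some $A'\in\mathcal F$ with $P(A')=0$ for all $P\in\mathcal P$; a property holds quasi surely (q.s.) if it holds outside a polar set. Let $L^0$ be the space of measurable functions $\Omega\to\mathbb R$ modulo q.s. equality, with the q.s. order; put $\|X\|_\infty=\inf\{m\ge 0: P(|X|>m)=0\ \forall P\in\mathcal P\}$, $L^\infty=\{X\in L^0:\|X\|_\infty<\infty\}$, and let $L^\infty_+$ be its set of q.s. nonnegative elements. Fix $W\in L^0$ with $W\ge 1$, and put $\|X\|_W=\|X/W\|_\infty$ and $L_W=\{X\in L^0:\|X\|_W<\infty\}$. Let $\mathcal K\subset L^0$ be a convex cone with $0\in\mathcal K$ and define, for $\lambda\ge 0$, $$\mathcal C=\{X\in L_W: X\le k\text{ for some }k\in\mathcal K\},\qquad \mathcal C_\lambda=\{X\in L_W: X\le k\text{ for some }k\in\mathcal K\text{ with }k\ge-\lambda W\},$$ $$\widetilde{\mathcal C}=\{X\in L_W:\ \forall P\in\mathcal P\ \exists Y\in\mathcal C\text{ with }X=Y\ P\text{-a.s.}\}.$$ Sensitive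 No Free Lunch with Vanishing Risk (sNFLVR) is the condition $\mathrm{cl}(\widetilde{\mathcal C})\cap L^\infty_+=\{0\}$, where $\mathrm{cl}(\mathcal A)$ is the $\|\cdot\|_\infty$-closure in $L^\infty$ of $\mathcal A\cap L^\infty$. A set $\mathcal A\subset L_W$ is Fatou closed if it contains every q.s. limit of every $\|\cdot\|_W$-bounded sequence in $\mathcal A$. An approximate separating class is a sequence $\mathcal Q=(Q_n)_{n\ge1}$ of probability measures on $(\Omega,\mathcal F)$ for which there is $P\in\mathcal P$ with $Q_n\ll P$ for all $n$, and such that for every $n\ge 1$ and every $X\in\mathcal C_n$ the expectation $E_{Q_n}[X]=E_{Q_n}[X^+]-E_{Q_n}[X^-]$ is well defined in $[-\infty,\infty]$ and satisfies $E_{Q_n}[X]\le\frac1n$. Let $\mathcal Q_{app}$ be the collection of approximate separating classes. **Theorem.** Suppose that if sNFLVR holds then $\mathcal C$ is Fatou closed. Then the following are equivalent: 1. sNFLVR. 2. $\mathcal Q_{app}\approx\mathcal P$, i.e. an event $A\in\mathcal F$ is null under every $P\in\mathcal P$ if and only if it is null under every probability belonging to some approximate separating class; and moreover, for every non-polar $A\in\mathcal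 F$ there exist $\delta>0$ and $\mathcal Q\in\mathcal Q_{app}$ such that $\inf_{Q\in\mathcal Q}Q(A)\ge\delta$. -/

import Mathlib

open MeasureTheory Filter Topology
open scoped ENNReal

noncomputable section

namespace QuasiSure

variable {Ω : Type*} [MeasurableSpace Ω]

/-- `𝔓₂` dominates `𝔓₁`: every event that is null for all of `𝔓₂` is null for all of `𝔓₁`. -/
def Dominated (𝔓₁ 𝔓₂ : Set (ProbabilityMeasure Ω)) : Prop :=
  ∀ A : Set Ω, MeasurableSet A →
    (∀ P ∈ 𝔓₂, (P : Measure Ω) A = 0) → ∀ P ∈ 𝔓₁, (P : Measure Ω) A = 0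

/-- Equivalence of two classes of probabilities. -/
def EquivClasses (𝔓₁ 𝔓₂ : Set (ProbabilityMeasure Ω)) : Prop :=
  Dominated 𝔓₁ 𝔓₂ ∧ Dominated 𝔓₂ 𝔓₁

/-- Polar sets: subsets of events that are null under every `P ∈ 𝔓`. -/
def IsPolar (𝔓 : Set (ProbabilityMeasure Ω)) (A : Set Ω) : Prop :=
  ∃ A' : Set Ω, MeasurableSet A' ∧ A ⊆ A' ∧ ∀ P ∈ 𝔓, (P : Measure Ω) A' = 0

/-- The (in general not σ-finite) sum of all `P ∈ 𝔓`. It is only used through its null sets, which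
are exactly the polar sets (`qsMeasure_eq_zero_iff`), so that "`qsMeasure 𝔓`-almost everywhere"
means "`𝔓`-quasi surely". -/
def qsMeasure (𝔓 : Set (ProbabilityMeasure Ω)) : Measure Ω :=
  Measure.sum fun P : 𝔓 => ((P : ProbabilityMeasure Ω) : Measure Ω)

theorem qsMeasure_eq_zero_iff_of_measurableSet (𝔓 : Set (ProbabilityMeasure Ω)) {A : Set Ω}
    (hA : MeasurableSet A) :
    qsMeasure 𝔓 A = 0 ↔ ∀ P ∈ 𝔓, (P : Measure Ω) A = 0 := by
  rw [qsMeasure, Measure.sum_apply _ hA, ENNReal.tsum_eq_zero]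
  exact Subtype.forall

/-- The null sets of `qsMeasure 𝔓` are the polar sets. -/
theorem qsMeasure_eq_zero_iff (𝔓 : Set (ProbabilityMeasure Ω)) (A : Set Ω) :
    qsMeasure 𝔓 A = 0 ↔ IsPolar 𝔓 A := by
  constructor
  · intro h
    refine ⟨toMeasurable (qsMeasure 𝔓) A, measurableSet_toMeasurable _ _,
      subset_toMeasurable _ _, ?_⟩
    rw [← qsMeasure_eq_zero_iff_of_measurableSet 𝔓 (measurableSet_toMeasurable _ _),
      measure_toMeasurable, h]
  · rintro ⟨A', hA', hsub, h0⟩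
    exact measure_mono_null hsub ((qsMeasure_eq_zero_iff_of_measurableSet 𝔓 hA').2 h0)

/-- `L⁰`: measurable real functions, identified when quasi surely equal. Its vector space structure
and its order are Mathlib's, i.e. the quasi-sure ones. -/
abbrev L0 (𝔓 : Set (ProbabilityMeasure Ω)) := Ω →ₘ[qsMeasure 𝔓] ℝ

/-- The order of `L⁰` is the quasi-sure order. -/
theorem L0_le_iff (𝔓 : Set (ProbabilityMeasure Ω)) (X Y : L0 𝔓) :
    X ≤ Y ↔ ∀ P ∈ 𝔓, (P : Measure Ω) {ω | Y ω < X ω} = 0 := by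
  rw [← AEEqFun.coeFn_le, EventuallyLE, ae_iff, ← qsMeasure_eq_zero_iff_of_measurableSet]
  · simp only [not_le]
  · exact measurableSet_lt Y.measurable X.measurable

/-- The quasi-sure supremum norm `inf {m | P(|f| > m) = 0 ∀ P ∈ 𝔓}`, with value `∞` when `f` is
not quasi surely bounded. -/
def qsNorm (𝔓 : Set (ProbabilityMeasure Ω)) (f : Ω → ℝ) : ℝ≥0∞ :=
  sInf {m : ℝ≥0∞ | ∀ P ∈ 𝔓, (P : Measure Ω) {ω | m < ‖f ω‖ₑ} = 0}

/-- `L^∞`: quasi surely bounded functions. -/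
def Linf (𝔓 : Set (ProbabilityMeasure Ω)) : Set (L0 𝔓) :=
  {X | qsNorm 𝔓 X < ∞}

/-- The nonnegative elements of `L^∞`. -/
def LinfPlus (𝔓 : Set (ProbabilityMeasure Ω)) : Set (L0 𝔓) :=
  {X | X ∈ Linf 𝔓 ∧ 0 ≤ X}

/-- The weighted norm `‖X‖_W = ‖X / W‖_∞`. -/
def normW {𝔓 : Set (ProbabilityMeasure Ω)} (W X : L0 𝔓) : ℝ≥0∞ :=
  qsNorm 𝔓 fun ω => X ω / W ω

/-- `L_W`: the `X` for which `X / W` is quasi surely bounded. -/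
def LW {𝔓 : Set (ProbabilityMeasure Ω)} (W : L0 𝔓) : Set (L0 𝔓) :=
  {X | normW W X < ∞}

/-- The `‖·‖_∞`-closure, in `L^∞`, of `𝒜 ∩ L^∞`. -/
def normClosure {𝔓 : Set (ProbabilityMeasure Ω)} (𝒜 : Set (L0 𝔓)) : Set (L0 𝔓) :=
  {X | X ∈ Linf 𝔓 ∧ ∀ ε : ℝ≥0∞, 0 < ε → ∃ Y ∈ 𝒜 ∩ Linf 𝔓, qsNorm 𝔓 (X - Y : L0 𝔓) < ε}

/-- The super-replication cone `C = {X ∈ L_W | X ≤ k for some k ∈ K}`. -/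
def superCone {𝔓 : Set (ProbabilityMeasure Ω)} (W : L0 𝔓) (K : PointedCone ℝ (L0 𝔓)) :
    Set (L0 𝔓) :=
  {X | X ∈ LW W ∧ ∃ k ∈ K, X ≤ k}

/-- `C_lam = {X ∈ L_W | X ≤ k for some k ∈ K with k ≥ -lam W}`. -/
def superConeBdd {𝔓 : Set (ProbabilityMeasure Ω)} (W : L0 𝔓) (K : PointedCone ℝ (L0 𝔓))
    (lam : ℝ) : Set (L0 𝔓) :=
  {X | X ∈ LW W ∧ ∃ k ∈ K, -(lam • W) ≤ k ∧ X ≤ k}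

/-- The projection `j_P : L⁰ → L⁰(P)` sending `X` to its `P`-almost sure class. -/
def proj {𝔓 : Set (ProbabilityMeasure Ω)} (P : ProbabilityMeasure Ω) (X : L0 𝔓) :
    Ω →ₘ[(P : Measure Ω)] ℝ :=
  AEEqFun.mk X X.stronglyMeasurable.aestronglyMeasurable

/-- The intersection over `P ∈ 𝔓` of the sets `j_P⁻¹(j_P(𝒜))`, as subsets of `L_W`. -/
def sensitiveHull {𝔓 : Set (ProbabilityMeasure Ω)} (W : L0 𝔓) (𝒜 : Set (L0 𝔓)) : Set (L0 𝔓) :=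
  {X | X ∈ LW W ∧ ∀ P ∈ 𝔓, X ∈ proj P ⁻¹' (proj P '' 𝒜)}

/-- Sensitive No Free Lunch with Vanishing Risk. -/
def SNFLVR {𝔓 : Set (ProbabilityMeasure Ω)} (W : L0 𝔓) (K : PointedCone ℝ (L0 𝔓)) : Prop :=
  normClosure (sensitiveHull W (superCone W K)) ∩ LinfPlus 𝔓 = {0}

/-- Fatou closedness: quasi-sure limits of `‖·‖_W`-bounded sequences in `𝒜` belong to `𝒜`. -/
def FatouClosed {𝔓 : Set (ProbabilityMeasure Ω)} (W : L0 𝔓) (𝒜 : Set (L0 𝔓)) : Prop :=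
  ∀ (X : ℕ → L0 𝔓) (Y : L0 𝔓), (∀ n, X n ∈ 𝒜) → (∃ M : ℝ≥0∞, M < ∞ ∧ ∀ n, normW W (X n) ≤ M) →
    (∀ᵐ ω ∂qsMeasure 𝔓, Tendsto (fun n => X n ω) atTop (𝓝 (Y ω))) → Y ∈ 𝒜

/-- The expectation `E_Q[f⁺] - E_Q[f⁻]` is well defined in `[-∞, ∞]`. -/
def HasExpectation (Q : ProbabilityMeasure Ω) (f : Ω → ℝ) : Prop :=
  ∫⁻ ω, ENNReal.ofReal (f ω) ∂(Q : Measure Ω) ≠ ∞ ∨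
    ∫⁻ ω, ENNReal.ofReal (-f ω) ∂(Q : Measure Ω) ≠ ∞

/-- The expectation `E_Q[f⁺] - E_Q[f⁻] ∈ [-∞, ∞]` (only used where it is well defined). -/
def expectation (Q : ProbabilityMeasure Ω) (f : Ω → ℝ) : EReal :=
  ((∫⁻ ω, ENNReal.ofReal (f ω) ∂(Q : Measure Ω) : ℝ≥0∞) : EReal) -
    ((∫⁻ ω, ENNReal.ofReal (-f ω) ∂(Q : Measure Ω) : ℝ≥0∞) : EReal)

/-- Approximate separating classes: sequences `(Q_n)_{n ≥ 1}` of probabilities, all absolutely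
continuous with respect to one `P ∈ 𝔓`, with `E_{Q_n}[X] ≤ 1 / n` for all `X ∈ C_n`. -/
def Qapp {𝔓 : Set (ProbabilityMeasure Ω)} (W : L0 𝔓) (K : PointedCone ℝ (L0 𝔓)) :
    Set (ℕ+ → ProbabilityMeasure Ω) :=
  {Q | (∃ P ∈ 𝔓, ∀ n, (Q n : Measure Ω) ≪ (P : Measure Ω)) ∧
    ∀ n : ℕ+, ∀ X ∈ superConeBdd W K (n : ℝ),
      HasExpectation (Q n) X ∧ expectation (Q n) X ≤ ((1 / (n : ℝ) : ℝ) : EReal)}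

/-- All the probabilities that belong to some approximate separating class. -/
def QappUnion {𝔓 : Set (ProbabilityMeasure Ω)} (W : L0 𝔓) (K : PointedCone ℝ (L0 𝔓)) :
    Set (ProbabilityMeasure Ω) :=
  ⋃ Q ∈ Qapp W K, Set.range Q

end QuasiSure

end

open QuasiSure

namespace QuasiSure

/-! From sNFLVR to separating classes: if `A` is not polar, then for some `e > 0` and some `P` the
function `1_A - e` agrees `P`-a.s. with no element of `C`; otherwise all `1_A - e` would lie in the
sensitive hull and `1_A` in its closure (`SNFLVR.exists_forall_not_ae_eq`). Division by `W` embeds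
each `C_lam` as a convex set in `L²(P)`. Fatou closedness keeps `(1_A - e) / W` out of its closure
(`exists_mem_superCone_of_tendsto_ae`), so Hahn-Banach yields a density, nonnegative because `C_lam`
contains large negative functions (`exists_probabilityMeasure_integral_le`). Taking `lam = n²` and
scaling by `n` gives both the bound `1/n` on `C_n` and `Q_n(A) ≥ e`.

Conversely, only the uniform lower bound matters. A nonzero `X ≥ 0` in the closure has `E_{Q_n}[X] ≥
aδ` for all `n`, while elements of the hull have expectation at most `1/n` for large `n`
(`integral_le_of_mem_sensitiveHull`). -/

theorem abs_div_le_iff {x w m : ℝ} (hw : 1 ≤ w) : |x / w| ≤ m ↔ |x| ≤ m * w := by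
  have : 0 < w := by linarith
  rw [abs_div, abs_of_pos this, div_le_iff₀ this]

theorem abs_indicator_one_sub_le {α : Type*} (A : Set α) {e : ℝ} (he : 0 ≤ e) (ω : α) :
    |A.indicator 1 ω - e| ≤ 1 + e := by
  by_cases h : ω ∈ A
  · rw [Set.indicator_of_mem h, Pi.one_apply, abs_le]
    constructor <;> linarith
  · rw [Set.indicator_of_notMem h, abs_le]
    constructor <;> linarith

theorem indicator_one_sub_le_one {α : Type*} (A : Set α) {e : ℝ} (he : 0 ≤ e) (ω : α) :
    A.indicator 1 ω - e ≤ 1 := by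
  by_cases h : ω ∈ A
  · rw [Set.indicator_of_mem h, Pi.one_apply]
    linarith
  · rw [Set.indicator_of_notMem h]
    linarith

variable {Ω : Type*} [MeasurableSpace Ω] {𝔓 : Set (ProbabilityMeasure Ω)}

/-! ### Quasi-sure bounds and norms -/

theorem absolutelyContinuous_qsMeasure {P : ProbabilityMeasure Ω} (hP : P ∈ 𝔓) :
    (P : Measure Ω) ≪ qsMeasure 𝔓 :=
  Measure.absolutelyContinuous_sum_right (μs := fun P : 𝔓 => ((P : ProbabilityMeasure Ω) :
    Measure Ω)) ⟨P, hP⟩ Measure.AbsolutelyContinuous.rfl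

theorem ae_qsMeasure_iff {p : Ω → Prop} (hp : MeasurableSet {ω | ¬ p ω}) :
    (∀ᵐ ω ∂qsMeasure 𝔓, p ω) ↔ ∀ P ∈ 𝔓, (P : Measure Ω) {ω | ¬ p ω} = 0 := by
  rw [ae_iff, qsMeasure_eq_zero_iff_of_measurableSet _ hp]

theorem ae_enorm_le_of_qsNorm_lt {f : Ω → ℝ} (hf : Measurable f) {m : ℝ≥0∞}
    (h : qsNorm 𝔓 f < m) : ∀ᵐ ω ∂qsMeasure 𝔓, ‖f ω‖ₑ ≤ m := by
  obtain ⟨a, ha, ham⟩ := sInf_lt_iff.1 h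
  have : ∀ᵐ ω ∂qsMeasure 𝔓, ‖f ω‖ₑ ≤ a := by
    rw [ae_qsMeasure_iff]
    · simpa only [not_le, Set.mem_ofPred_eq] using ha
    · simp only [not_le]
      exact measurableSet_lt measurable_const hf.enorm
  filter_upwards [this] with ω hω using hω.trans ham.le

theorem ae_abs_le_of_qsNorm_lt {f : Ω → ℝ} (hf : Measurable f) {m : ℝ} (hm : 0 ≤ m)
    (h : qsNorm 𝔓 f < ENNReal.ofReal m) : ∀ᵐ ω ∂qsMeasure 𝔓, |f ω| ≤ m := by
  filter_upwards [ae_enorm_le_of_qsNorm_lt hf h] with ω hω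
  rwa [← ofReal_norm, ENNReal.ofReal_le_ofReal_iff hm, Real.norm_eq_abs] at hω

theorem qsNorm_le_ofReal {f : Ω → ℝ} {m : ℝ} (h : ∀ᵐ ω ∂qsMeasure 𝔓, |f ω| ≤ m) :
    qsNorm 𝔓 f ≤ ENNReal.ofReal m := by
  refine sInf_le fun P hP => ?_
  have := (absolutelyContinuous_qsMeasure hP).ae_le h
  rw [← nonpos_iff_eq_zero, ← ae_iff.1 this]
  refine measure_mono fun ω hω hle => ?_
  rw [Set.mem_ofPred_eq, ← ofReal_norm, Real.norm_eq_abs] at hω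
  exact absurd (ENNReal.ofReal_le_ofReal hle) (not_le.2 hω)

theorem qsNorm_lt_top_iff {f : Ω → ℝ} (hf : Measurable f) :
    qsNorm 𝔓 f < ∞ ↔ ∃ m : ℝ, ∀ᵐ ω ∂qsMeasure 𝔓, |f ω| ≤ m := by
  constructor
  · intro h
    obtain ⟨a, ha, ha'⟩ := exists_between h
    lift a to NNReal using ha'.ne
    exact ⟨a, ae_abs_le_of_qsNorm_lt hf a.2 (by simpa using ha)⟩
  · rintro ⟨m, h⟩
    exact (qsNorm_le_ofReal h).trans_lt ENNReal.ofReal_lt_top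

theorem mem_Linf_iff {X : L0 𝔓} :
    X ∈ Linf 𝔓 ↔ ∃ m : ℝ, ∀ᵐ ω ∂qsMeasure 𝔓, |X ω| ≤ m :=
  qsNorm_lt_top_iff X.measurable

variable {W : L0 𝔓}

theorem ae_one_le (hW : 1 ≤ W) : ∀ᵐ ω ∂qsMeasure 𝔓, 1 ≤ W ω := by
  filter_upwards [AEEqFun.coeFn_le.2 hW, AEEqFun.coeFn_one (α := Ω) (β := ℝ) (μ := qsMeasure 𝔓)]
    with ω h1 h2
  rwa [h2] at h1

theorem normW_le_ofReal (hW : 1 ≤ W) {X : L0 𝔓} {m : ℝ}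
    (h : ∀ᵐ ω ∂qsMeasure 𝔓, |X ω| ≤ m * W ω) : normW W X ≤ ENNReal.ofReal m := by
  refine qsNorm_le_ofReal ?_
  filter_upwards [h, ae_one_le hW] with ω h1 h2 using (abs_div_le_iff h2).2 h1

theorem mem_LW_iff (hW : 1 ≤ W) {X : L0 𝔓} :
    X ∈ LW W ↔ ∃ m : ℝ, ∀ᵐ ω ∂qsMeasure 𝔓, |X ω| ≤ m * W ω := by
  refine (qsNorm_lt_top_iff (X.measurable.div W.measurable)).trans (exists_congr fun m => ?_)
  refine eventually_congr ?_
  filter_upwards [ae_one_le hW] with ω h using abs_div_le_iff h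

/-! ### The cones `C` and `C_lam` -/

theorem mem_superCone_of_le {K : PointedCone ℝ (L0 𝔓)} {X Y : L0 𝔓} (hX : X ∈ LW W) (hXY : X ≤ Y)
    (hY : Y ∈ superCone W K) : X ∈ superCone W K :=
  ⟨hX, hY.2.imp fun _ hk => ⟨hk.1, hXY.trans hk.2⟩⟩

theorem mem_superConeBdd_iff (hW : 1 ≤ W) {K : PointedCone ℝ (L0 𝔓)} {lam : ℝ} {X : L0 𝔓} :
    X ∈ superConeBdd W K lam ↔ (∃ m : ℝ, ∀ᵐ ω ∂qsMeasure 𝔓, |X ω| ≤ m * W ω) ∧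
      ∃ k ∈ K, ∀ᵐ ω ∂qsMeasure 𝔓, -(lam * W ω) ≤ k ω ∧ X ω ≤ k ω := by
  rw [← mem_LW_iff hW]
  refine and_congr_right fun _ => exists_congr fun k => and_congr_right fun _ => ?_
  rw [eventually_and]
  refine and_congr ?_ AEEqFun.coeFn_le.symm
  rw [← AEEqFun.coeFn_le]
  refine eventually_congr ?_
  filter_upwards [AEEqFun.coeFn_neg (lam • W), AEEqFun.coeFn_smul lam W] with ω h1 h2
  rw [h1, Pi.neg_apply, h2, Pi.smul_apply, smul_eq_mul]

theorem superConeBdd_subset_superCone {K : PointedCone ℝ (L0 𝔓)} {lam : ℝ} :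
    superConeBdd W K lam ⊆ superCone W K :=
  fun _ hX => ⟨hX.1, hX.2.imp fun _ hk => ⟨hk.1, hk.2.2⟩⟩

/-- A dominating `k` inherits the lower bound `-mW` of `X ∈ L_W`, so `C` is the union of the
`C_lam`. -/
theorem exists_mem_superConeBdd (hW : 1 ≤ W) {K : PointedCone ℝ (L0 𝔓)} {X : L0 𝔓}
    (hX : X ∈ superCone W K) : ∃ m : ℝ, ∀ lam, m ≤ lam → X ∈ superConeBdd W K lam := by
  obtain ⟨hL, k, hk, hXk⟩ := hX
  obtain ⟨m, hm⟩ := (mem_LW_iff hW).1 hL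
  refine ⟨m, fun lam hlam => (mem_superConeBdd_iff hW).2 ⟨⟨m, hm⟩, k, hk, ?_⟩⟩
  filter_upwards [hm, AEEqFun.coeFn_le.2 hXk, ae_one_le hW] with ω h1 h2 h3
  have := (abs_le.1 h1).1
  exact ⟨by nlinarith, h2⟩

theorem mem_superConeBdd_of_nonpos (hW : 1 ≤ W) {K : PointedCone ℝ (L0 𝔓)} {lam m : ℝ}
    (hlam : 0 ≤ lam) {X : L0 𝔓} (hX : ∀ᵐ ω ∂qsMeasure 𝔓, -(m * W ω) ≤ X ω ∧ X ω ≤ 0) :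
    X ∈ superConeBdd W K lam := by
  refine (mem_superConeBdd_iff hW).2 ⟨⟨m, ?_⟩, 0, K.zero_mem, ?_⟩
  · filter_upwards [hX] with ω h
    rw [abs_of_nonpos h.2]
    linarith
  · filter_upwards [hX, ae_one_le hW, AEEqFun.coeFn_zero (α := Ω) (β := ℝ) (μ := qsMeasure 𝔓)]
      with ω h h1 h2
    rw [h2, Pi.zero_apply]
    exact ⟨by nlinarith, h.2⟩

theorem add_smul_mem_superConeBdd (hW : 1 ≤ W) {K : PointedCone ℝ (L0 𝔓)} {r s a b : ℝ}
    {X Y : L0 𝔓} (hX : X ∈ superConeBdd W K r) (hY : Y ∈ superConeBdd W K s)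
    (ha : 0 ≤ a) (hb : 0 ≤ b) : a • X + b • Y ∈ superConeBdd W K (a * r + b * s) := by
  rw [mem_superConeBdd_iff hW] at hX hY ⊢
  obtain ⟨⟨m, hm⟩, k, hk, hXk⟩ := hX
  obtain ⟨⟨n, hn⟩, l, hl, hYl⟩ := hY
  refine ⟨⟨a * m + b * n, ?_⟩, a • k + b • l,
    K.add_mem (K.smul_mem ha hk) (K.smul_mem hb hl), ?_⟩
  · filter_upwards [hm, hn, AEEqFun.coeFn_add (a • X) (b • Y), AEEqFun.coeFn_smul a X,
      AEEqFun.coeFn_smul b Y] with ω h1 h2 h3 h4 h5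
    rw [h3, Pi.add_apply, h4, h5, Pi.smul_apply, Pi.smul_apply, smul_eq_mul, smul_eq_mul, abs_le]
    rw [abs_le] at h1 h2
    constructor <;> nlinarith
  · filter_upwards [hXk, hYl, AEEqFun.coeFn_add (a • X) (b • Y), AEEqFun.coeFn_smul a X,
      AEEqFun.coeFn_smul b Y, AEEqFun.coeFn_add (a • k) (b • l), AEEqFun.coeFn_smul a k,
      AEEqFun.coeFn_smul b l] with ω h1 h2 h3 h4 h5 h6 h7 h8
    rw [h3, h6, Pi.add_apply, Pi.add_apply, h4, h5, h7, h8]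
    simp only [Pi.smul_apply, smul_eq_mul]
    constructor <;> nlinarith

theorem smul_mem_superConeBdd (hW : 1 ≤ W) {K : PointedCone ℝ (L0 𝔓)} {r a : ℝ}
    {X : L0 𝔓} (hX : X ∈ superConeBdd W K r) (ha : 0 ≤ a) :
    a • X ∈ superConeBdd W K (a * r) := by
  simpa using add_smul_mem_superConeBdd hW hX hX ha le_rfl

/-! ### Expectations and almost sure classes -/

theorem expectation_eq_integral {Q : ProbabilityMeasure Ω} {f : Ω → ℝ}
    (hf : Integrable f (Q : Measure Ω)) :
    HasExpectation Q f ∧ expectation Q f = ((∫ ω, f ω ∂(Q : Measure Ω) : ℝ) : EReal) := by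
  have h1 : ∫⁻ ω, ENNReal.ofReal (f ω) ∂(Q : Measure Ω) ≠ ∞ := hf.lintegral_lt_top.ne
  have h2 : ∫⁻ ω, ENNReal.ofReal (-f ω) ∂(Q : Measure Ω) ≠ ∞ := hf.neg.lintegral_lt_top.ne
  refine ⟨Or.inl h1, ?_⟩
  rw [integral_eq_lintegral_pos_part_sub_lintegral_neg_part hf, EReal.coe_sub,
    EReal.coe_ennreal_toReal h1, EReal.coe_ennreal_toReal h2, expectation]

theorem expectation_congr {Q : ProbabilityMeasure Ω} {f g : Ω → ℝ}
    (h : f =ᵐ[(Q : Measure Ω)] g) : expectation Q f = expectation Q g := by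
  have h' : ∫⁻ ω, ENNReal.ofReal (-f ω) ∂(Q : Measure Ω) =
      ∫⁻ ω, ENNReal.ofReal (-g ω) ∂(Q : Measure Ω) :=
    lintegral_congr_ae (h.mono fun ω hω => by simp only [hω])
  rw [expectation, expectation, h', lintegral_congr_ae (h.mono fun ω hω => by rw [hω])]

theorem proj_eq_proj_iff {P : ProbabilityMeasure Ω} {X Y : L0 𝔓} :
    proj P X = proj P Y ↔ X =ᵐ[(P : Measure Ω)] Y :=
  AEEqFun.mk_eq_mk

/-! ### From `P`-a.s. limits to Fatou closedness -/

/-- Under Fatou closedness, a truncated almost sure limit, for one `P`, of elements of `C_lam` is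
`P`-almost surely equal to an element of `C`. -/
theorem exists_mem_superCone_of_tendsto_ae (hW : 1 ≤ W) {K : PointedCone ℝ (L0 𝔓)}
    (hF : FatouClosed W (superCone W K)) {P : ProbabilityMeasure Ω} (hP : P ∈ 𝔓)
    {lam : ℝ} (hlam : 0 ≤ lam) {X : ℕ → L0 𝔓} (hX : ∀ n, X n ∈ superConeBdd W K lam)
    {f : Ω → ℝ} (hf : Measurable f) {m : ℝ} (hfm : ∀ ω, |f ω| ≤ m) (hf1 : ∀ ω, f ω ≤ 1)
    (hlim : ∀ᵐ ω ∂(P : Measure Ω), Tendsto (fun n => X n ω) atTop (𝓝 (f ω))) :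
    ∃ Y ∈ superCone W K, Y =ᵐ[(P : Measure Ω)] f := by
  obtain ⟨N, hN, hNm, hN0⟩ := exists_measurable_superset_of_null (ae_iff.1 hlim)
  have hNc : ∀ ω, ω ∉ N → Tendsto (fun n => X n ω) atTop (𝓝 (f ω)) := fun ω hω => by
    by_contra h
    exact hω (hN h)
  classical
  have hWm := W.measurable
  -- `N` is the exceptional `P`-null set, possibly not polar. Freezing the value there makes
  -- convergence hold everywhere. Since `X n ≤ k` and `-lam W ≤ k`, the truncation stays below `k`,
  -- and it is bounded in `‖·‖_W`.
  let T : (Ω → ℝ) → Ω → ℝ := fun g => N.piecewise (fun ω => -(lam * W ω))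
    fun ω => min (max (g ω) (-(lam * W ω))) (W ω)
  have hT : ∀ g, Measurable g → Measurable (T g) := fun g hg =>
    Measurable.piecewise hNm (by fun_prop) (by fun_prop)
  have hTN : ∀ g, ∀ ω ∈ N, T g ω = -(lam * W ω) := fun g ω hω => Set.piecewise_eq_of_mem _ _ _ hω
  have hTc : ∀ g, ∀ ω ∉ N, T g ω = min (max (g ω) (-(lam * W ω))) (W ω) := fun g ω hω =>
    Set.piecewise_eq_of_notMem _ _ _ hω
  have hTb : ∀ g, ∀ᵐ ω ∂qsMeasure 𝔓, |T g ω| ≤ (lam + 1) * W ω := by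
    intro g
    filter_upwards [ae_one_le hW] with ω h1
    have h2 : 0 ≤ lam * W ω := by nlinarith
    by_cases hω : ω ∈ N
    · rw [hTN _ _ hω, abs_neg, abs_of_nonneg h2]
      linarith
    · rw [hTc _ _ hω, abs_le]
      refine ⟨le_min ((le_max_right _ _).trans' (by linarith)) (by linarith),
        (min_le_right _ _).trans (by linarith)⟩
  let X' : ℕ → L0 𝔓 := fun n =>
    AEEqFun.mk (T (X n)) (hT _ (X n).measurable).aestronglyMeasurable
  let Y' : L0 𝔓 := AEEqFun.mk (T f) (hT f hf).aestronglyMeasurable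
  have hX'e : ∀ n, X' n =ᵐ[qsMeasure 𝔓] T (X n) := fun n => AEEqFun.coeFn_mk _ _
  have hY'e : Y' =ᵐ[qsMeasure 𝔓] T f := AEEqFun.coeFn_mk _ _
  have hX'b : ∀ n, ∀ᵐ ω ∂qsMeasure 𝔓, |X' n ω| ≤ (lam + 1) * W ω := fun n => by
    filter_upwards [hX'e n, hTb (X n)] with ω h1 h2
    rwa [h1]
  have hY' : Y' ∈ superCone W K := by
    refine hF X' Y' (fun n => ?_) ⟨ENNReal.ofReal (lam + 1), ENNReal.ofReal_lt_top,
      fun n => normW_le_ofReal hW (hX'b n)⟩ ?_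
    · obtain ⟨-, k, hk, hXk⟩ := (mem_superConeBdd_iff hW).1 (hX n)
      refine ⟨(mem_LW_iff hW).2 ⟨_, hX'b n⟩, k, hk, AEEqFun.coeFn_le.1 ?_⟩
      filter_upwards [hX'e n, hXk] with ω h1 h2
      rw [h1]
      by_cases hω : ω ∈ N
      · rw [hTN _ _ hω]
        exact h2.1
      · rw [hTc _ _ hω]
        exact (min_le_left _ _).trans (max_le h2.2 h2.1)
    · filter_upwards [ae_all_iff.2 hX'e, hY'e] with ω h1 h2
      simp only [h1, h2]
      by_cases hω : ω ∈ N
      · simp only [hTN _ _ hω]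
        exact tendsto_const_nhds
      · simp only [hTc _ _ hω]
        exact ((hNc ω hω).max tendsto_const_nhds).min tendsto_const_nhds
  -- `T f` may exceed `f` where `f < -lam W`; as `f ≤ 1 ≤ W`, it is q.s. never smaller off `N`. So
  -- `Z`, equal to `f` off `N`, lies below an element of `C`.
  let Z : Ω → ℝ := N.piecewise (fun ω => -(lam * W ω)) f
  have hZN : ∀ ω ∈ N, Z ω = -(lam * W ω) := fun ω hω => Set.piecewise_eq_of_mem _ _ _ hω
  have hZc : ∀ ω ∉ N, Z ω = f ω := fun ω hω => Set.piecewise_eq_of_notMem _ _ _ hω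
  have hZ : Measurable Z := Measurable.piecewise hNm (by fun_prop) hf
  have hZe : (AEEqFun.mk Z hZ.aestronglyMeasurable : L0 𝔓) =ᵐ[qsMeasure 𝔓] Z :=
    AEEqFun.coeFn_mk _ _
  refine ⟨AEEqFun.mk Z hZ.aestronglyMeasurable, mem_superCone_of_le
    ((mem_LW_iff hW).2 ⟨lam + m, ?_⟩) (AEEqFun.coeFn_le.1 ?_) hY', ?_⟩
  · filter_upwards [hZe, ae_one_le hW] with ω h1 h2
    have h3 := hfm ω
    have h4 : 0 ≤ m := (abs_nonneg _).trans h3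
    have h5 : 0 ≤ lam * W ω := by nlinarith
    rw [h1]
    by_cases hω : ω ∈ N
    · rw [hZN _ hω, abs_neg, abs_of_nonneg h5]
      nlinarith
    · rw [hZc _ hω]
      nlinarith
  · filter_upwards [hZe, hY'e, ae_one_le hW] with ω h1 h2 h3
    rw [h1, h2]
    by_cases hω : ω ∈ N
    · simp only [hTN _ _ hω, hZN _ hω, le_refl]
    · simp only [hTc _ _ hω, hZc _ hω]
      exact le_min (le_max_left _ _) ((hf1 ω).trans h3)
  · filter_upwards [(absolutelyContinuous_qsMeasure hP).ae_le hZe,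
      measure_eq_zero_iff_ae_notMem.1 hN0] with ω h1 h2
    rw [h1, hZc _ h2]

/-! ### Separation in `L²(P)` -/

/-- Integration against the density `η / w` is the inner product of `L²` after division by `w`. -/
theorem integral_withDensity_div_eq_inner {μ : Measure Ω} {w : Ω → ℝ} (hw : Measurable w)
    (hw1 : ∀ᵐ ω ∂μ, 1 ≤ w ω) {η : Lp ℝ 2 μ} (hη : ∀ᵐ ω ∂μ, 0 ≤ η ω) {g : Ω → ℝ}
    (hg : MemLp (fun ω => g ω / w ω) 2 μ) :
    Integrable g (μ.withDensity fun ω => ENNReal.ofReal (η ω / w ω)) ∧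
      ∫ ω, g ω ∂(μ.withDensity fun ω => ENNReal.ofReal (η ω / w ω)) =
        inner ℝ η (hg.toLp fun ω => g ω / w ω) := by
  have hm : Measurable fun ω => ENNReal.ofReal (η ω / w ω) :=
    ((Lp.stronglyMeasurable η).measurable.div hw).ennreal_ofReal
  have hlt : ∀ᵐ ω ∂μ, ENNReal.ofReal (η ω / w ω) < ∞ := ae_of_all _ fun _ => ENNReal.ofReal_lt_top
  have he : (fun ω => (ENNReal.ofReal (η ω / w ω)).toReal • g ω) =ᵐ[μ]
      fun ω => inner ℝ (η ω) (hg.toLp (fun ω => g ω / w ω) ω) := by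
    filter_upwards [hw1, hη, hg.coeFn_toLp] with ω h1 h2 h3
    rw [h3, ENNReal.toReal_ofReal (div_nonneg h2 (by linarith)), smul_eq_mul]
    simp only [RCLike.inner_apply, conj_trivial]
    ring
  rw [integrable_withDensity_iff_integrable_smul' hm hlt,
    integral_withDensity_eq_integral_toReal_smul hm hlt, L2.inner_def]
  exact ⟨(L2.integrable_inner η _).congr he.symm, integral_congr_ae he⟩

theorem memLp_div_of_mem_LW (hW : 1 ≤ W) {P : ProbabilityMeasure Ω} (hP : P ∈ 𝔓) {X : L0 𝔓}
    (hX : X ∈ LW W) : MemLp (fun ω => X ω / W ω) 2 (P : Measure Ω) := by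
  obtain ⟨m, hm⟩ := (mem_LW_iff hW).1 hX
  refine MemLp.of_bound (X.measurable.div W.measurable).aestronglyMeasurable m ?_
  filter_upwards [(absolutelyContinuous_qsMeasure hP).ae_le hm,
    (absolutelyContinuous_qsMeasure hP).ae_le (ae_one_le hW)] with ω h1 h2
  exact (abs_div_le_iff h2).2 h1

/-- If `f` is not `P`-almost surely equal to an element of `C`, some probability separates it from
`C_lam`. -/
theorem exists_probabilityMeasure_integral_le (hW : 1 ≤ W) {K : PointedCone ℝ (L0 𝔓)}
    (hF : FatouClosed W (superCone W K)) {P : ProbabilityMeasure Ω} (hP : P ∈ 𝔓)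
    {lam : ℝ} (hlam : 0 ≤ lam) {f : Ω → ℝ} (hf : Measurable f) {m : ℝ} (hfm : ∀ ω, |f ω| ≤ m)
    (hf1 : ∀ ω, f ω ≤ 1) (hfC : ∀ Y ∈ superCone W K, ¬ Y =ᵐ[(P : Measure Ω)] f) :
    ∃ Q : ProbabilityMeasure Ω, (Q : Measure Ω) ≪ (P : Measure Ω) ∧
      ∀ X ∈ superConeBdd W K lam, Integrable X (Q : Measure Ω) ∧
        ∫ ω, X ω ∂(Q : Measure Ω) ≤ ∫ ω, f ω ∂(Q : Measure Ω) := by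
  have hac := absolutelyContinuous_qsMeasure hP
  have hW1 := hac.ae_le (ae_one_le hW)
  have hfL : MemLp (fun ω => f ω / W ω) 2 (P : Measure Ω) := by
    refine MemLp.of_bound (hf.div W.measurable).aestronglyMeasurable m ?_
    filter_upwards [hW1] with ω h1
    refine (abs_div_le_iff h1).2 ((hfm ω).trans ?_)
    have := (abs_nonneg _).trans (hfm ω)
    nlinarith
  let S : Set (Lp ℝ 2 (P : Measure Ω)) :=
    {z | ∃ X ∈ superConeBdd W K lam, z =ᵐ[(P : Measure Ω)] fun ω => X ω / W ω}
  have hSconv : Convex ℝ S := by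
    rintro x ⟨X, hX, hx⟩ y ⟨Y, hY, hy⟩ a b ha hb hab
    refine ⟨a • X + b • Y, ?_, ?_⟩
    · convert add_smul_mem_superConeBdd hW hX hY ha hb using 1
      rw [← add_mul, hab, one_mul]
    · filter_upwards [hx, hy, Lp.coeFn_add (a • x) (b • y), Lp.coeFn_smul a x, Lp.coeFn_smul b y,
        hac.ae_le (AEEqFun.coeFn_add (a • X) (b • Y)), hac.ae_le (AEEqFun.coeFn_smul a X),
        hac.ae_le (AEEqFun.coeFn_smul b Y)] with ω h1 h2 h3 h4 h5 h6 h7 h8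
      rw [h3, h6, Pi.add_apply, Pi.add_apply, h4, h5, h7, h8]
      simp only [Pi.smul_apply, smul_eq_mul, h1, h2]
      ring
  have hgS : hfL.toLp _ ∉ closure S := by
    intro hcl
    obtain ⟨z, hz, hzlim⟩ := mem_closure_iff_seq_limit.1 hcl
    obtain ⟨ns, -, hns⟩ := (tendstoInMeasure_of_tendsto_Lp hzlim).exists_seq_tendsto_ae
    choose X hX hzX using hz
    obtain ⟨Y, hY, hYf⟩ := exists_mem_superCone_of_tendsto_ae hW hF hP hlam
      (X := fun n => X (ns n)) (fun n => hX _) hf hfm hf1 (by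
        filter_upwards [hns, ae_all_iff.2 hzX, hfL.coeFn_toLp, hW1] with ω h1 h2 h3 h4
        have hne : W ω ≠ 0 := by linarith
        rw [h3] at h1
        simpa only [h2, div_mul_cancel₀ _ hne] using h1.mul_const (W ω))
    exact hfC Y hY hYf
  obtain ⟨φ, u, hφ, hu⟩ := geometric_hahn_banach_closed_point hSconv.closure isClosed_closure hgS
  obtain ⟨η, rfl⟩ := (InnerProductSpace.toDual ℝ (Lp ℝ 2 (P : Measure Ω))).surjective φ
  simp only [InnerProductSpace.toDual_apply_apply] at hφ hu
  have hφX : ∀ X (hX : X ∈ superConeBdd W K lam),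
      inner ℝ η ((memLp_div_of_mem_LW hW hP hX.1).toLp _) < u := fun X hX =>
    hφ _ (subset_closure ⟨X, hX, MemLp.coeFn_toLp _⟩)
  have hη : ∀ᵐ ω ∂(P : Measure Ω), 0 ≤ η ω := by
    have hηm := (Lp.stronglyMeasurable η).measurable
    have hNm : MeasurableSet {ω | η ω < 0} := measurableSet_lt hηm measurable_const
    have hI : Integrable (fun ω => max (-η ω) 0) (P : Measure Ω) :=
      ((Lp.memLp η).integrable one_le_two).neg_part
    -- Tested on `-t W 1_{η < 0}`, the functional equals `t ∫ η⁻`; a bound uniform in `t` forces `∫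
    -- η⁻ = 0`.
    have key : ∀ t : ℝ, 0 ≤ t → t * ∫ ω, max (-η ω) 0 ∂(P : Measure Ω) < u := by
      intro t ht
      have hgm : Measurable fun ω => -t * {ω | η ω < 0}.indicator W ω :=
        (W.measurable.indicator hNm).const_mul _
      have hge := AEEqFun.coeFn_mk (μ := qsMeasure 𝔓) _ hgm.aestronglyMeasurable
      have hmem : AEEqFun.mk _ hgm.aestronglyMeasurable ∈ superConeBdd W K lam := by
        refine mem_superConeBdd_of_nonpos (m := t) hW hlam ?_
        filter_upwards [hge, ae_one_le hW] with ω h1 h2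
        rw [h1]
        by_cases hω : η ω < 0
        · rw [Set.indicator_of_mem (by exact hω)]
          constructor <;> nlinarith
        · rw [Set.indicator_of_notMem (by exact hω)]
          constructor <;> nlinarith
      refine lt_of_eq_of_lt ?_ (hφX _ hmem)
      rw [L2.inner_def, ← integral_const_mul]
      refine integral_congr_ae ?_
      filter_upwards [(memLp_div_of_mem_LW hW hP hmem.1).coeFn_toLp, hac.ae_le hge, hW1]
        with ω h1 h2 h3
      have hne : W ω ≠ 0 := by linarith
      rw [h1, h2, RCLike.inner_apply, conj_trivial]
      by_cases hω : η ω < 0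
      · rw [Set.indicator_of_mem (by exact hω), mul_div_cancel_right₀ _ hne, max_eq_left (by linarith)]
        ring
      · rw [Set.indicator_of_notMem (by exact hω), max_eq_right (by linarith)]
        ring
    have hI0 : 0 ≤ ∫ ω, max (-η ω) 0 ∂(P : Measure Ω) :=
      integral_nonneg fun ω => le_max_right _ _
    have hIz : ∫ ω, max (-η ω) 0 ∂(P : Measure Ω) = 0 := by
      by_contra hne
      have hu0 : 0 < u := by simpa using key 0 le_rfl
      have := key (u / ∫ ω, max (-η ω) 0 ∂(P : Measure Ω)) (div_nonneg hu0.le hI0)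
      rw [div_mul_cancel₀ _ hne] at this
      exact lt_irrefl _ this
    filter_upwards [(integral_eq_zero_iff_of_nonneg (fun ω => le_max_right _ _) hI).1 hIz] with ω h
    have : -η ω ≤ 0 := (le_max_left _ _).trans_eq h
    linarith
  have h0 : (0 : L0 𝔓) ∈ superConeBdd W K lam := by
    refine mem_superConeBdd_of_nonpos (m := 0) hW hlam ?_
    filter_upwards [AEEqFun.coeFn_zero (α := Ω) (β := ℝ) (μ := qsMeasure 𝔓)] with ω h
    simp [h]
  set ν := (P : Measure Ω).withDensity fun ω => ENNReal.ofReal (η ω / W ω) with hν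
  have hνX : ∀ X ∈ superConeBdd W K lam, Integrable X ν ∧ ∫ ω, X ω ∂ν < ∫ ω, f ω ∂ν := by
    intro X hX
    obtain ⟨h1, h2⟩ := integral_withDensity_div_eq_inner W.measurable hW1 hη
      (memLp_div_of_mem_LW hW hP hX.1)
    obtain ⟨-, h4⟩ := integral_withDensity_div_eq_inner W.measurable hW1 hη hfL
    refine ⟨h1, ?_⟩
    rw [hν, h2, h4]
    exact (hφX X hX).trans hu
  have hνac : ν ≪ (P : Measure Ω) := withDensity_absolutelyContinuous _ _
  -- Strict separation at `X = 0` gives `0 < ∫ f ∂ν`, so `ν` can be normalised.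
  have hν0 : ν Set.univ ≠ 0 := by
    intro h
    rw [Measure.measure_univ_eq_zero] at h
    simpa [h] using (hνX 0 h0).2
  have hνfin : IsFiniteMeasure ν := by
    refine isFiniteMeasure_withDensity_ofReal (Integrable.mono
      ((Lp.memLp η).integrable one_le_two)
      ((Lp.stronglyMeasurable η).measurable.div W.measurable).aestronglyMeasurable ?_).2
    filter_upwards [hW1] with ω h1
    rw [Pi.div_apply, norm_div, Real.norm_eq_abs (W ω), abs_of_pos (by linarith)]
    exact div_le_self (norm_nonneg _) h1
  have hprob : IsProbabilityMeasure ((ν Set.univ)⁻¹ • ν) := ⟨by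
    rw [Measure.smul_apply, smul_eq_mul, ENNReal.inv_mul_cancel hν0 (measure_ne_top _ _)]⟩
  refine ⟨⟨_, hprob⟩, hνac.smul_left _, fun X hX => ?_⟩
  rw [ProbabilityMeasure.coe_mk, integral_smul_measure, integral_smul_measure]
  exact ⟨(hνX X hX).1.smul_measure (ENNReal.inv_ne_top.2 hν0),
    mul_le_mul_of_nonneg_left (hνX X hX).2.le ENNReal.toReal_nonneg⟩

/-! ### From sNFLVR to approximate separating classes -/

theorem zero_mem_superCone (hW : 1 ≤ W) {K : PointedCone ℝ (L0 𝔓)} :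
    (0 : L0 𝔓) ∈ superCone W K := by
  refine superConeBdd_subset_superCone (lam := 0)
    (mem_superConeBdd_of_nonpos (m := 0) hW le_rfl ?_)
  filter_upwards [AEEqFun.coeFn_zero (α := Ω) (β := ℝ) (μ := qsMeasure 𝔓)] with ω h
  simp [h]

theorem SNFLVR.exists_forall_not_ae_eq (hW : 1 ≤ W) {K : PointedCone ℝ (L0 𝔓)}
    (h : SNFLVR W K) {A : Set Ω} (hA : MeasurableSet A) (hAp : ¬ IsPolar 𝔓 A) :
    ∃ e : ℝ, 0 < e ∧ ∃ P ∈ 𝔓, ∀ Y ∈ superCone W K,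
      ¬ Y =ᵐ[(P : Measure Ω)] fun ω => A.indicator 1 ω - e := by
  by_contra! hcon
  have h1m : Measurable (A.indicator 1 : Ω → ℝ) := measurable_one.indicator hA
  have h1e := AEEqFun.coeFn_mk (μ := qsMeasure 𝔓) _ h1m.aestronglyMeasurable
  have hLinf : (AEEqFun.mk _ h1m.aestronglyMeasurable : L0 𝔓) ∈ Linf 𝔓 := by
    refine mem_Linf_iff.2 ⟨1, ?_⟩
    filter_upwards [h1e] with ω h1
    rw [h1]
    simpa using abs_indicator_one_sub_le A le_rfl ω
  have hmem : (AEEqFun.mk _ h1m.aestronglyMeasurable : L0 𝔓) ∈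
      normClosure (sensitiveHull W (superCone W K)) ∩ LinfPlus 𝔓 := by
    refine ⟨⟨hLinf, fun ε hε => ?_⟩, hLinf, AEEqFun.coeFn_le.1 ?_⟩
    · obtain ⟨e, he, heε⟩ : ∃ e : ℝ, 0 < e ∧ ENNReal.ofReal e < ε := by
        obtain ⟨r, hr, hrε⟩ := ENNReal.lt_iff_exists_nnreal_btwn.1 hε
        exact ⟨r, by simpa using hr, by simpa using hrε⟩
      have hem : Measurable fun ω => (A.indicator 1 ω - e : ℝ) := h1m.sub_const e
      have hee := AEEqFun.coeFn_mk (μ := qsMeasure 𝔓) _ hem.aestronglyMeasurable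
      refine ⟨AEEqFun.mk _ hem.aestronglyMeasurable,
        ⟨⟨(mem_LW_iff hW).2 ⟨1 + e, ?_⟩, fun P hP => ?_⟩, mem_Linf_iff.2 ⟨1 + e, ?_⟩⟩,
        (qsNorm_le_ofReal ?_).trans_lt heε⟩
      · filter_upwards [hee, ae_one_le hW] with ω h1 h2
        rw [h1]
        exact (abs_indicator_one_sub_le A he.le ω).trans (by nlinarith)
      · obtain ⟨Y, hY, hYe⟩ := hcon e he P hP
        exact ⟨Y, hY, proj_eq_proj_iff.2
          (hYe.trans ((absolutelyContinuous_qsMeasure hP).ae_eq hee).symm)⟩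
      · filter_upwards [hee] with ω h1
        rw [h1]
        exact abs_indicator_one_sub_le A he.le ω
      · filter_upwards [h1e, hee, AEEqFun.coeFn_sub
          (AEEqFun.mk _ h1m.aestronglyMeasurable : L0 𝔓) (AEEqFun.mk _ hem.aestronglyMeasurable)]
          with ω h1 h2 h3
        rw [h3, Pi.sub_apply, h1, h2, sub_sub_cancel, abs_of_pos he]
    · filter_upwards [h1e, AEEqFun.coeFn_zero (α := Ω) (β := ℝ) (μ := qsMeasure 𝔓)] with ω h1 h2
      rw [h1, h2]
      exact Set.indicator_nonneg (fun _ _ => zero_le_one) ω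
  rw [h, Set.mem_singleton_iff] at hmem
  refine hAp ((qsMeasure_eq_zero_iff 𝔓 A).1 (measure_eq_zero_iff_ae_notMem.2 ?_))
  filter_upwards [h1e, AEEqFun.coeFn_zero (α := Ω) (β := ℝ) (μ := qsMeasure 𝔓)] with ω h1 h2 hω
  rw [hmem, h2, Set.indicator_of_mem hω] at h1
  simp at h1

/-- The same `e` and `P` serve every `lam`, so all the `Q n` share one dominating measure and one
lower bound `δ = e`. -/
theorem SNFLVR.exists_mem_Qapp (hW : 1 ≤ W) {K : PointedCone ℝ (L0 𝔓)}
    (h : SNFLVR W K) (hF : FatouClosed W (superCone W K)) {A : Set Ω} (hA : MeasurableSet A)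
    (hAp : ¬ IsPolar 𝔓 A) :
    ∃ δ : ℝ, 0 < δ ∧ ∃ Q ∈ Qapp W K, ENNReal.ofReal δ ≤ ⨅ n : ℕ+, (Q n : Measure Ω) A := by
  obtain ⟨e, he, P, hP, hPe⟩ := h.exists_forall_not_ae_eq hW hA hAp
  have h1m : Measurable (A.indicator 1 : Ω → ℝ) := measurable_one.indicator hA
  -- For `X ∈ C_n`, `n X ∈ C_{n²}`, so `n E[X] ≤ Q_n(A) - e ≤ 1`.
  choose Q hQP hQ using fun n : ℕ+ => exists_probabilityMeasure_integral_le hW hF hP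
    (lam := (n : ℝ) * n) (by positivity) (h1m.sub_const e) (abs_indicator_one_sub_le A he.le)
    (indicator_one_sub_le_one A he.le) hPe
  have hint : ∀ n, ∫ ω, (A.indicator 1 ω - e) ∂(Q n : Measure Ω) =
      (Q n : Measure Ω).real A - e := by
    intro n
    have h1i : Integrable (A.indicator 1 : Ω → ℝ) (Q n : Measure Ω) :=
      (integrable_const (1 : ℝ)).indicator hA
    rw [integral_sub h1i (integrable_const e),
      integral_indicator_one hA, integral_const, probReal_univ, one_smul]
  refine ⟨e, he, Q, ⟨⟨P, hP, hQP⟩, fun n X hX => ?_⟩, le_iInf fun n => ?_⟩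
  · have hn : (0 : ℝ) < n := by exact_mod_cast n.pos
    obtain ⟨hi, hle⟩ := hQ n _ (smul_mem_superConeBdd hW hX hn.le)
    have hae : (n : ℝ) • X =ᵐ[(Q n : Measure Ω)] fun ω => (n : ℝ) * X ω :=
      ((hQP n).trans (absolutelyContinuous_qsMeasure hP)).ae_eq (AEEqFun.coeFn_smul (n : ℝ) X)
    have hi' : Integrable X (Q n : Measure Ω) :=
      (integrable_const_mul_iff hn.ne'.isUnit _).1 (hi.congr hae)
    obtain ⟨h1, h2⟩ := expectation_eq_integral hi'
    refine ⟨h1, ?_⟩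
    rw [h2, EReal.coe_le_coe_iff, le_div_iff₀ hn, mul_comm, ← integral_const_mul,
      ← integral_congr_ae hae]
    refine hle.trans ?_
    rw [hint]
    have := measureReal_le_one (μ := (Q n : Measure Ω)) (s := A)
    linarith
  -- Separation at `X = 0` reads `0 ≤ Q_n(A) - e`.
  · have hle := (hQ n 0 (mem_superConeBdd_of_nonpos (m := 0) hW (by positivity) (by
      filter_upwards [AEEqFun.coeFn_zero (α := Ω) (β := ℝ) (μ := qsMeasure 𝔓)] with ω h
      simp [h]))).2
    have hae : (0 : L0 𝔓) =ᵐ[(Q n : Measure Ω)] 0 :=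
      ((hQP n).trans (absolutelyContinuous_qsMeasure hP)).ae_eq AEEqFun.coeFn_zero
    rw [hint, integral_eq_zero_of_ae hae] at hle
    rw [← ofReal_measureReal]
    exact ENNReal.ofReal_le_ofReal (by linarith)

/-! ### From approximate separating classes to sNFLVR -/

/-- One `P` dominates the whole class, so `Y` may be replaced by a single `Z ∈ C`, which lies in
`C_n` for all large `n`. -/
theorem integral_le_of_mem_sensitiveHull (hW : 1 ≤ W) {K : PointedCone ℝ (L0 𝔓)}
    {Q : ℕ+ → ProbabilityMeasure Ω} (hQ : Q ∈ Qapp W K) {Y : L0 𝔓}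
    (hY : Y ∈ sensitiveHull W (superCone W K)) (hYi : ∀ n, Integrable Y (Q n : Measure Ω)) :
    ∃ N : ℕ+, ∀ n, N ≤ n → ∫ ω, Y ω ∂(Q n : Measure Ω) ≤ 1 / (n : ℝ) := by
  obtain ⟨⟨P, hP, hQP⟩, hQn⟩ := hQ
  obtain ⟨Z, hZ, hZY⟩ := hY.2 P hP
  obtain ⟨m, hm⟩ := exists_mem_superConeBdd hW hZ
  refine ⟨⌈m⌉₊.succPNat, fun n hn => ?_⟩
  have hmn : m ≤ n := by
    have h1 : (⌈m⌉₊ : ℝ) ≤ n := by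
      have : ⌈m⌉₊.succ ≤ n := hn
      exact_mod_cast (Nat.le_succ _).trans this
    exact (Nat.le_ceil m).trans h1
  have := (hQn n Z (hm _ hmn)).2
  rwa [expectation_congr ((hQP n).ae_eq (proj_eq_proj_iff.1 hZY)),
    (expectation_eq_integral (hYi n)).2, EReal.coe_le_coe_iff] at this

theorem sNFLVR_of_exists_mem_Qapp (hW : 1 ≤ W) {K : PointedCone ℝ (L0 𝔓)}
    (h : ∀ A : Set Ω, MeasurableSet A → ¬ IsPolar 𝔓 A →
      ∃ δ : ℝ, 0 < δ ∧ ∃ Q ∈ Qapp W K, ENNReal.ofReal δ ≤ ⨅ n : ℕ+, (Q n : Measure Ω) A) :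
    SNFLVR W K := by
  have hz := AEEqFun.coeFn_zero (α := Ω) (β := ℝ) (μ := qsMeasure 𝔓)
  refine Set.Subset.antisymm ?_ (Set.singleton_subset_iff.2 ?_)
  · rintro X ⟨⟨-, hX⟩, hXb, hX0⟩
    by_contra hne
    obtain ⟨a, ha, hA⟩ : ∃ a : ℝ, 0 < a ∧ ¬ IsPolar 𝔓 {ω | a ≤ X ω} := by
      by_contra! hcon
      refine hne (le_antisymm (AEEqFun.coeFn_le.1 ?_) hX0)
      have : ∀ n : ℕ, ∀ᵐ ω ∂qsMeasure 𝔓, X ω < 1 / ((n : ℝ) + 1) := fun n => by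
        have := (qsMeasure_eq_zero_iff 𝔓 _).2 (hcon (1 / ((n : ℝ) + 1)) (by positivity))
        filter_upwards [measure_eq_zero_iff_ae_notMem.1 this] with ω hω using not_le.1 hω
      filter_upwards [ae_all_iff.2 this, hz] with ω h1 h2
      rw [h2]
      exact ge_of_tendsto' tendsto_one_div_add_atTop_nhds_zero_nat fun n => (h1 n).le
    have hAm : MeasurableSet {ω | a ≤ X ω} := measurableSet_le measurable_const X.measurable
    obtain ⟨δ, hδ, Q, hQ, hQδ⟩ := h _ hAm hA
    obtain ⟨P, hP, hQP⟩ := hQ.1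
    have hac : ∀ n, (Q n : Measure Ω) ≪ qsMeasure 𝔓 := fun n =>
      (hQP n).trans (absolutelyContinuous_qsMeasure hP)
    have hint : ∀ Z ∈ Linf 𝔓, ∀ n, Integrable Z (Q n : Measure Ω) := fun Z hZ n => by
      obtain ⟨m, hm⟩ := mem_Linf_iff.1 hZ
      exact Integrable.of_bound Z.measurable.aestronglyMeasurable m ((hac n).ae_le hm)
    -- Two errors below `aδ/3`, up to equality, namely `‖X - Y‖_∞` and `1/n`, cannot add up to the
    -- Markov bound `aδ ≤ E_{Q_n}[X]`.
    have haδ : 0 < a * δ / 3 := by positivity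
    obtain ⟨Y, ⟨hYC, hYb⟩, hXY⟩ := hX (ENNReal.ofReal (a * δ / 3)) (by simpa using haδ)
    obtain ⟨N, hN⟩ := integral_le_of_mem_sensitiveHull hW hQ hYC (hint Y hYb)
    obtain ⟨M, hM⟩ := exists_nat_one_div_lt haδ
    let n : ℕ+ := max N M.succPNat
    have hn : 1 / (n : ℝ) ≤ 1 / ((M : ℝ) + 1) := by
      refine one_div_le_one_div_of_le (by positivity) ?_
      have : M.succ ≤ (n : ℕ) := (le_max_right N M.succPNat : M.succPNat ≤ n)
      exact_mod_cast this
    have hYn := hN n (le_max_left _ _)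
    have hdiff : ∫ ω, X ω ∂(Q n : Measure Ω) ≤ ∫ ω, (Y ω + a * δ / 3) ∂(Q n : Measure Ω) := by
      refine integral_mono_ae (hint X hXb n) ((hint Y hYb n).add (integrable_const _)) ?_
      filter_upwards [(hac n).ae_le (ae_abs_le_of_qsNorm_lt (X - Y).measurable haδ.le hXY),
        (hac n).ae_le (AEEqFun.coeFn_sub X Y)] with ω h1 h2
      rw [h2, Pi.sub_apply, abs_le] at h1
      linarith [h1.2]
    rw [integral_add (hint Y hYb n) (integrable_const _), integral_const, probReal_univ,
      one_smul] at hdiff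
    have hmarkov : a * (Q n : Measure Ω).real {ω | a ≤ X ω} ≤ ∫ ω, X ω ∂(Q n : Measure Ω) := by
      refine mul_meas_ge_le_integral_of_nonneg ?_ (hint X hXb n) a
      filter_upwards [(hac n).ae_le (AEEqFun.coeFn_le.2 hX0), (hac n).ae_le hz] with ω h1 h2
      rwa [h2] at h1
    have hδA : δ ≤ (Q n : Measure Ω).real {ω | a ≤ X ω} := by
      refine (ENNReal.ofReal_le_iff_le_toReal (measure_ne_top _ _)).1 (hQδ.trans (iInf_le _ n))
    nlinarith
  · have hLinf : (0 : L0 𝔓) ∈ Linf 𝔓 := mem_Linf_iff.2 ⟨0, by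
      filter_upwards [hz] with ω h
      simp [h]⟩
    refine ⟨⟨hLinf, fun ε hε => ⟨0, ⟨⟨(zero_mem_superCone (K := K) hW).1, fun P _ =>
      ⟨0, zero_mem_superCone hW, rfl⟩⟩, hLinf⟩, ?_⟩⟩, hLinf, le_rfl⟩
    refine lt_of_le_of_lt (qsNorm_le_ofReal (m := 0) ?_) (by simpa using hε)
    filter_upwards [hz] with ω h
    simp [h]

end QuasiSure

/-! ### The equivalence -/

theorem theorem2p1 {Ω : Type*} [MeasurableSpace Ω] (𝔓 : Set (ProbabilityMeasure Ω))
    (W : L0 𝔓) (hW : 1 ≤ W) (K : PointedCone ℝ (L0 𝔓))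
    (hFatou : SNFLVR W K → FatouClosed W (superCone W K)) :
    SNFLVR W K ↔
      EquivClasses (QappUnion W K) 𝔓 ∧
        ∀ A : Set Ω, MeasurableSet A → ¬ IsPolar 𝔓 A →
          ∃ δ : ℝ, 0 < δ ∧ ∃ Q ∈ Qapp W K,
            ENNReal.ofReal δ ≤ ⨅ n : ℕ+, (Q n : Measure Ω) A := by
  refine ⟨fun h => ?_, fun h => sNFLVR_of_exists_mem_Qapp hW h.2⟩
  have hδ := fun A hA hAp => h.exists_mem_Qapp hW (hFatou h) (A := A) hA hAp
  refine ⟨⟨fun A hA h0 Q' hQ' => ?_, fun A hA h0 P hP => ?_⟩, hδ⟩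
  · obtain ⟨Q, hQ, n, rfl⟩ := Set.mem_iUnion₂.1 hQ'
    obtain ⟨P, hP, hQP⟩ := hQ.1
    exact hQP n (h0 P hP)
  -- The lower bound already gives this domination: a non-polar `A` is charged by the first member
  -- of some class.
  · have hpolar : IsPolar 𝔓 A := by
      by_contra hAp
      obtain ⟨δ, hδ0, Q, hQ, hle⟩ := hδ A hA hAp
      have := hle.trans (iInf_le _ 1)
      rw [h0 (Q 1) (Set.mem_iUnion₂.2 ⟨Q, hQ, 1, rfl⟩), nonpos_iff_eq_zero,
        ENNReal.ofReal_eq_zero] at this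
      exact absurd hδ0 (not_lt.2 this)
    exact (qsMeasure_eq_zero_iff_of_measurableSet 𝔓 hA).1 ((qsMeasure_eq_zero_iff 𝔓 A).2 hpolar) P hP
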